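/- **Setting.** Let $\bar A\in\{0,\star\}^{n\times n}$, $\bar B\in\{0,\star\}^{n\times m}$, $\bar C\in\{0,\star\}^{p\times n}$ be a structured system with dedicated inputs and outputs: each column of $\bar B$ and each row of $\bar C$ contains exactly one $\star$. Let $P\in[0,\infty]^{m\times p}$ be a feedback cost matrix; $P_{ij}$ is the cost of the feedback edge $(y_j,u_i)$, which feeds output $y_j$ to input $u_i$, and the edge is feasible if $P_{ij}<\infty$. A numerical realization of a structured matrix is a real matrix of the same size that vanishes wherever the structured matrix has a $0$. For $\bar K\in\{0,\star\}^{m\times p}$ let $[\bar K]$ be the set of its numerical realizations. $(\bar A,\bar B,\bar C,\bar K)$ has no structurally fixed modes if there are numerical realizations $A,B,C$ of $\bar A,\bar B,\bar C$ with $\bigcap_{K\in[\bar K]}\sigma(A+BKC)=\emptyset$, where $\sigma$ denotes the set of complex eigenvalues. Let $\mathcal K$ be the set of all such $\bar K\in\{0,\star\}^{m\times p}$, and $P(\bar K)=\sum_{(i,j):\bar K_{ij}=\star}P_{ij}$. *Problem 1:* minimize $P(\bar K)$ over $\bar K\in\mathcal K$. The state digraph has vertices $x_1,\dots,x_n$ and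 an edge $(x_j,x_i)$ whenever $\bar A_{ij}=\star$. Let $\mathcal N$ be the set of its strongly connected components. For $a,b\in\mathcal N$ let $E_{ab}$ be the set of feasible feedback edges $(y_j,u_i)$ such that the state actuated by $u_i$ lies in $a$ and the state sensed by $y_j$ lies in $b$. Let $E_{\min}$ be a set of feedback edges, each of which has least cost in some $E_{ab}$, that contains at least one least-cost edge of every nonempty $E_{ab}$ (for example, one selected from each, or all of them). For a set $E$ of feedback edges let $\mathcal D(E)$ be the digraph with vertices $\mathcal N\cup\{u_1,\dots,u_m\}\cup\{y_1,\dots,y_p\}$ and the following edges: $(a,b)$ for distinct $a,b\in\mathcal N$ such that some edge of the state digraph goes from $a$ to $b$; $(u_i,a)$ if the state actuated by $u_i$ lies in $a$; $(a,y_j)$ if the state sensed by $y_j$ lies in $a$; and all edges in $E$. In particular $\mathcal D_R=\mathcal D(E_{\min})$. Let $c(E)=\sum_{(y_j,u_i)\in E}P_{ij}$. *Problem 2 (optimal cycle selection on $\mathcal D_R$):* minimize $c(E)$ over the sets $E\subseteq E_{\min}$ such that each $a\in\mathcal N$ lies in at least one directed cycle of $\mathcal D(E)$. For $\epsilon\ge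 1$, an $\epsilon$-optimal solution of either problem is a feasible point whose cost is at most $\epsilon$ times the cost of an optimal solution. **Theorem.** Assume that the bipartite graph with parts $\{x_1',\dots,x_n'\}$, $\{x_1,\dots,x_n\}$ and an edge $(x_j',x_i)$ whenever $\bar A_{ji}=\star$ has a perfect matching. For a set $E'$ of feedback edges define $\bar K'$ by $\bar K'_{ij}=\star$ if and only if $(y_j,u_i)\in E'$. 1. For every $E'\subseteq E_{\min}$: $E'$ is an optimal solution of Problem 2 if and only if $\bar K'$ is an optimal solution of Problem 1. If $E_{\min}$ contains all the least-cost edges of every $E_{ab}$, this equivalence holds for every set $E'$ of feasible feedback edges. 2. For every real $\epsilon\ge1$: if $E'$ is an $\epsilon$-optimal solution of Problem 2, then $\bar K'$ is an $\epsilon$-optimal solution of Problem 1. -/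

import Mathlib

open scoped ENNReal NNReal

namespace StructuredControl

/-- A structured system with `n` states, `m` inputs and `p` outputs. In a structured matrix the
entry `true` is an indeterminate `⋆`, and the entry `false` is a fixed zero. -/
structure StructuredSystem (n m p : ℕ) where
  /-- state matrix -/
  A : Matrix (Fin n) (Fin n) Bool
  /-- input matrix -/
  B : Matrix (Fin n) (Fin m) Bool
  /-- output matrix -/
  C : Matrix (Fin p) (Fin n) Bool

/-- The numerical matrices with the zero pattern of a structured matrix. -/
def realizations {k l : ℕ} (M : Matrix (Fin k) (Fin l) Bool) :
    Set (Matrix (Fin k) (Fin l) ℝ) :=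
  {N | ∀ i j, M i j = false → N i j = 0}

/-- The set of (complex) eigenvalues of a real square matrix. -/
def eigenvalueSet {n : ℕ} (T : Matrix (Fin n) (Fin n) ℝ) : Set ℂ :=
  spectrum ℂ (T.map (algebraMap ℝ ℂ))

namespace StructuredSystem

variable {n m p : ℕ} (S : StructuredSystem n m p)

/-- Dedicated inputs and outputs: exactly one `⋆` in each column of the input matrix and exactly
one `⋆` in each row of the output matrix. -/
def Dedicated : Prop :=
  (∀ j, ∃! i, S.B i j = true) ∧ (∀ j, ∃! i, S.C j i = true)

/-- The system with feedback pattern `K` has no structurally fixed modes: some numerical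
realization has no eigenvalue common to all the closed-loop matrices `A + B K C`. -/
def NoSFM (K : Matrix (Fin m) (Fin p) Bool) : Prop :=
  ∃ A ∈ realizations S.A, ∃ B ∈ realizations S.B, ∃ C ∈ realizations S.C,
    ⋂ F ∈ realizations K, eigenvalueSet (A + B * F * C) = ∅

/-- The state digraph: there is an edge from `x_j` to `x_i` if the `(i, j)` entry is `⋆`. -/
def stateDigraph : Digraph (Fin n) where
  Adj j i := S.A i j = true

/-- The state bipartite graph: the left vertex `x'_j` is joined to the right vertex `x_i` if
there is an edge from `x_i` to `x_j` in the state digraph. -/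
def stateBipartite : SimpleGraph (Fin n ⊕ Fin n) where
  Adj
    | .inl j, .inr i => S.stateDigraph.Adj i j
    | .inr i, .inl j => S.stateDigraph.Adj i j
    | _, _ => False
  symm := ⟨by rintro (a | a) (b | b) h <;> exact h⟩
  loopless := ⟨by rintro (a | a) h <;> exact h⟩

/-- The state bipartite graph has a perfect matching. -/
def HasPerfectStateMatching : Prop :=
  ∃ M : S.stateBipartite.Subgraph, M.IsPerfectMatching

/-- Two states are equivalent if each is reachable from the other in the state digraph. -/
def sccSetoid : Setoid (Fin n) where
  r i j := Relation.ReflTransGen S.stateDigraph.Adj i j ∧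
    Relation.ReflTransGen S.stateDigraph.Adj j i
  iseqv :=
    { refl := fun _ => ⟨.refl, .refl⟩
      symm := fun h => ⟨h.2, h.1⟩
      trans := fun h h' => ⟨h.1.trans h'.1, h'.2.trans h.2⟩ }

/-- The strongly connected components of the state digraph. -/
def SCC : Type := Quotient S.sccSetoid

/-- The component that contains a given state. -/
def scc (i : Fin n) : S.SCC := Quotient.mk S.sccSetoid i

/-- There is an edge from the input `j` to some state of the component `a`. -/
def InputAt (j : Fin m) (a : S.SCC) : Prop :=
  ∃ i, S.scc i = a ∧ S.B i j = true

/-- There is an edge from some state of the component `a` to the output `j`. -/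
def OutputAt (a : S.SCC) (j : Fin p) : Prop :=
  ∃ i, S.scc i = a ∧ S.C j i = true

end StructuredSystem

/-- A feedback edge `(y_j, u_i)` from the output `j` to the input `i`, as the pair `(j, i)`. -/
abbrev FeedbackEdge (m p : ℕ) : Type := Fin p × Fin m

/-- The cost of a feedback edge: `P i j` is the cost of feeding the output `j` to the input `i`,
and the value `∞` says that this connection is infeasible. -/
def edgeCost {m p : ℕ} (P : Matrix (Fin m) (Fin p) ℝ≥0∞) (e : FeedbackEdge m p) : ℝ≥0∞ :=
  P e.2 e.1

/-- The cost of a set of feedback edges. -/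
noncomputable def edgeSetCost {m p : ℕ} (P : Matrix (Fin m) (Fin p) ℝ≥0∞)
    (E : Finset (FeedbackEdge m p)) : ℝ≥0∞ :=
  ∑ e ∈ E, edgeCost P e

/-- The cost of a feedback pattern: the sum of `P i j` over the positions of its `⋆` entries. -/
noncomputable def patternCost {m p : ℕ} (P : Matrix (Fin m) (Fin p) ℝ≥0∞)
    (K : Matrix (Fin m) (Fin p) Bool) : ℝ≥0∞ :=
  ∑ ij : Fin m × Fin p with K ij.1 ij.2 = true, P ij.1 ij.2

/-- The feedback pattern whose `(i, j)` entry is `⋆` exactly if `(y_j, u_i)` is in `E`. -/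
def patternOf {m p : ℕ} (E : Finset (FeedbackEdge m p)) : Matrix (Fin m) (Fin p) Bool :=
  fun i j => decide ((j, i) ∈ E)

/-- The set of feasible feedback edges. -/
def feasibleEdges {m p : ℕ} (P : Matrix (Fin m) (Fin p) ℝ≥0∞) : Set (FeedbackEdge m p) :=
  {e | edgeCost P e ≠ ∞}

/-- Vertices of the condensed digraphs: components, inputs and outputs. -/
inductive Node (X : Type) (m p : ℕ) : Type
  | comp (a : X)
  | input (i : Fin m)
  | output (j : Fin p)

/-- The vertex `v` lies in a directed cycle (without repeated vertices) of the digraph `G`. -/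
def LiesInCycle {V : Type} (G : Digraph V) (v : V) : Prop :=
  ∃ c : Cycle V, c.Nodup ∧ c.Chain G.Adj ∧ v ∈ c

namespace StructuredSystem

variable {n m p : ℕ} (S : StructuredSystem n m p)

/-- The condensed digraph with the set `E` of feedback edges. Its vertices are the components of
the state digraph, the inputs and the outputs; edges inside one component are contracted. -/
def condensedDigraph (E : Finset (FeedbackEdge m p)) : Digraph (Node S.SCC m p) where
  Adj
    | .comp a, .comp b => a ≠ b ∧
        ∃ i j, S.scc i = a ∧ S.scc j = b ∧ S.stateDigraph.Adj i j
    | .input j, .comp a => S.InputAt j a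
    | .comp a, .output j => S.OutputAt a j
    | .output j, .input i => (j, i) ∈ E
    | _, _ => False

variable (P : Matrix (Fin m) (Fin p) ℝ≥0∞)

/-- The feasible feedback edges from the component `b` to the component `a`: from an output of
`b` to an input of `a`. -/
def edgesBetween (a b : S.SCC) : Set (FeedbackEdge m p) :=
  {e | e ∈ feasibleEdges P ∧ S.InputAt e.2 a ∧ S.OutputAt b e.1}

/-- The feasible feedback edges of least cost from the component `b` to the component `a`. -/
def minEdgesBetween (a b : S.SCC) : Set (FeedbackEdge m p) :=
  {e | e ∈ S.edgesBetween P a b ∧ IsMinOn (edgeCost P) (S.edgesBetween P a b) e}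

/-- `Emin` is a reduced set of feedback edges: it consists of least-cost edges between components,
at least one for each ordered pair of components between which there is a feasible edge. Both the
selection of a single edge for each pair and the set of all the least-cost edges are covered. -/
structure IsReducedEdgeSet (Emin : Finset (FeedbackEdge m p)) : Prop where
  minimal : ∀ e ∈ Emin, ∃ a b, e ∈ S.minEdgesBetween P a b
  represented : ∀ a b, (S.edgesBetween P a b).Nonempty → ∃ e ∈ Emin, e ∈ S.minEdgesBetween P a b

/-- Feasible points of the optimal feedback selection problem. -/
def feedbackFeasible : Set (Matrix (Fin m) (Fin p) Bool) :=
  {K | S.NoSFM K}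

/-- `K` solves the optimal feedback selection problem. -/
def SolvesFeedbackSelection (K : Matrix (Fin m) (Fin p) Bool) : Prop :=
  K ∈ S.feedbackFeasible ∧ IsMinOn (patternCost P) S.feedbackFeasible K

/-- `K` is an `ε`-optimal solution of the optimal feedback selection problem. -/
def EpsOptimalFeedbackSelection (ε : ℝ≥0) (K : Matrix (Fin m) (Fin p) Bool) : Prop :=
  K ∈ S.feedbackFeasible ∧
    ∀ K₀, S.SolvesFeedbackSelection P K₀ → patternCost P K ≤ ε * patternCost P K₀

/-- Feasible points of the optimal cycle selection problem: subsets of `Emin` with which every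
component lies in a cycle of the condensed digraph. -/
def cycleFeasible (Emin : Finset (FeedbackEdge m p)) : Set (Finset (FeedbackEdge m p)) :=
  {E | E ⊆ Emin ∧ ∀ a : S.SCC, LiesInCycle (S.condensedDigraph E) (.comp a)}

/-- `E` solves the optimal cycle selection problem. -/
def SolvesCycleSelection (Emin E : Finset (FeedbackEdge m p)) : Prop :=
  E ∈ S.cycleFeasible Emin ∧ IsMinOn (edgeSetCost P) (S.cycleFeasible Emin) E

/-- `E` is an `ε`-optimal solution of the optimal cycle selection problem. -/
def EpsOptimalCycleSelection (ε : ℝ≥0) (Emin E : Finset (FeedbackEdge m p)) : Prop :=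
  E ∈ S.cycleFeasible Emin ∧
    ∀ E₀, S.SolvesCycleSelection P Emin E₀ → edgeSetCost P E ≤ ε * edgeSetCost P E₀

end StructuredSystem

end StructuredControl

open StructuredControl

/-! Under the matching hypothesis, absence of fixed modes is a combinatorial condition
(`noSFM_patternOf_iff`): every state lies on a closed walk of the closed-loop digraph that uses a
feedback edge. If a state `v` does not, its closed-loop strong component is a diagonal block of a
block triangular form that feedback cannot change, so the eigenvalues of this block are common
(`exists_common_eigenvalue`).

The converse, `exists_forall_exists_charpoly_eval_ne_zero`, fills all edges with algebraically
independent numbers and supposes that `t` is a common eigenvalue. The matching gives `t ≠ 0`. Take a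
minimal principal block `I` of the generic closed-loop matrix with eigenvalue `t`. Then `t` is
algebraic over the entries in `I`, so it remains an eigenvalue when all entries outside that block
are changed (`charpoly_fill_eval_eq_zero`). Since `t` is also an eigenvalue of the open-loop matrix,
no feedback edge lies inside `I`. The given closed walk therefore leaves `I` and returns; a tree
growing out of `I`, plus one returning edge, specializes to a matrix without eigenvalue `t`, a
contradiction.

The condensation of the state digraph is acyclic, so cycles in the condensed digraph amount to the
same condition (`forall_liesInCycle_iff`). The condition sees only which components a feedback edge
joins. Hence a feasible pattern of finite cost moves into `Emin` at no greater cost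
(`exists_mem_cycleFeasible_le`), and the comparison of optima follows. -/

namespace GenericSpectrum

open Matrix

/-! ### Specialization of algebraically independent entries. -/

/-- The matrix with entries read off from `z` at the positions where `b` is an index, and zeros
elsewhere. -/
def fill {κ ι R : Type*} [Zero R] (b : κ → κ → Option ι) (z : ι → R) : Matrix κ κ R :=
  fun y x => (b y x).elim 0 z

/-- A finite transcendence basis would make `ℝ` algebraic over a countable ring, hence countable. -/
theorem exists_algebraicIndependent_real (ι : Type) [Finite ι] :
    ∃ z : ι → ℝ, AlgebraicIndependent ℚ z := by
  obtain ⟨s, hs⟩ := exists_isTranscendenceBasis ℚ ℝ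
  have hinf : Infinite s := by
    by_contra h
    have hfin : Finite s := not_infinite_iff_finite.1 h
    have hcount : Cardinal.mk (Algebra.adjoin ℚ (Set.range ((↑) : s → ℝ))) ≤ Cardinal.aleph0 := by
      refine (Algebra.cardinalMk_adjoin_le ℚ _).trans ?_
      simp [Cardinal.mk_le_aleph0]
    have halg := hs.isAlgebraic
    have hle := Algebra.IsAlgebraic.cardinalMk_le_max
      (Algebra.adjoin ℚ (Set.range ((↑) : s → ℝ))) ℝ
    rw [max_eq_right hcount, Cardinal.mk_real] at hle
    exact absurd hle (not_le.2 Cardinal.aleph0_lt_continuum)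
  obtain ⟨n, ⟨e⟩⟩ := Finite.exists_equiv_fin ι
  have f := (Infinite.natEmbedding s)
  exact ⟨fun i => (f (e i) : ℝ),
    hs.1.comp (fun i => f (e i)) fun i j h => by
      simpa [Fin.ext_iff] using congrArg e.symm (Fin.ext (f.injective h))⟩

/-- The variables outside `s` stay algebraically independent over the integral closure of `ℚ[z ''
s]`, which contains `t`. The relation is thus the zero polynomial in them, and they may take any
values. -/
theorem eval₂_eq_zero_of_eqOn {ι : Type*} {z : ι → ℂ} (hz : AlgebraicIndependent ℚ z)
    (s : Set ι) {t : ℂ} (ht : IsIntegral (Algebra.adjoin ℚ (z '' s)) t)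
    (D : Polynomial (MvPolynomial ι ℚ))
    (h : D.eval₂ (MvPolynomial.eval₂Hom (algebraMap ℚ ℂ) z) t = 0)
    {z' : ι → ℂ} (hz' : Set.EqOn z' z s) :
    D.eval₂ (MvPolynomial.eval₂Hom (algebraMap ℚ ℂ) z') t = 0 := by
  classical
  let S := integralClosure (Algebra.adjoin ℚ (z '' s)) ℂ
  have hx : AlgebraicIndependent S (fun i : ↥sᶜ => z i) :=
    (hz.adjoin_of_disjoint (disjoint_compl_right (a := s))).integralClosure
  have hmem : ∀ i ∈ s, z i ∈ S := fun i hi =>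
    S.algebraMap_mem (⟨z i, Algebra.subset_adjoin ⟨i, hi, rfl⟩⟩ : Algebra.adjoin ℚ (z '' s))
  let φ : MvPolynomial ι ℚ →+* MvPolynomial ↥sᶜ S :=
    MvPolynomial.eval₂Hom
      ((MvPolynomial.C.comp (algebraMap (Algebra.adjoin ℚ (z '' s)) S)).comp (algebraMap ℚ _))
      (fun i => if hi : i ∈ s then MvPolynomial.C ⟨z i, hmem i hi⟩ else MvPolynomial.X ⟨i, hi⟩)
  let Q : MvPolynomial ↥sᶜ S := D.eval₂ φ (MvPolynomial.C ⟨t, ht⟩)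
  have key : ∀ w : ι → ℂ, Set.EqOn w z s →
      MvPolynomial.aeval (fun i : ↥sᶜ => w i) Q =
        D.eval₂ (MvPolynomial.eval₂Hom (algebraMap ℚ ℂ) w) t := by
    intro w hw
    have h1 : (MvPolynomial.aeval (R := S) (fun i : ↥sᶜ => w i) : _ →+* ℂ).comp φ =
        MvPolynomial.eval₂Hom (algebraMap ℚ ℂ) w := by
      apply MvPolynomial.ringHom_ext'
      · exact Subsingleton.elim _ _
      · intro i
        by_cases hi : i ∈ s
        · simp [φ, hi, hw hi]
        · simp [φ, hi]
    have h2 := Polynomial.hom_eval₂ D φ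
      (MvPolynomial.aeval (R := S) (fun i : ↥sᶜ => w i) : _ →+* ℂ) (MvPolynomial.C ⟨t, ht⟩)
    rw [h1] at h2
    simpa [Q, Subalgebra.algebraMap_def] using h2
  have hQ : Q = 0 := by
    have h3 := key z (fun _ _ => rfl)
    rw [h] at h3
    exact (injective_iff_map_eq_zero _).1 hx Q h3
  rw [← key z' hz', hQ, map_zero]

/-! ### Minimal principal blocks with a given eigenvalue, and their extensions. -/

/-- The principal submatrix on `I`, padded by zeros. -/
def principal {κ : Type*} [DecidableEq κ] (I : Finset κ) (M : Matrix κ κ ℂ) : Matrix κ κ ℂ :=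
  fun y x => if y ∈ I ∧ x ∈ I then M y x else 0

theorem principal_transpose {κ : Type*} [DecidableEq κ] (I : Finset κ) (M : Matrix κ κ ℂ) :
    (principal I M)ᵀ = principal I Mᵀ := by
  ext y x
  simp [principal, and_comm]

variable {κ : Type*} [Fintype κ] [DecidableEq κ]

theorem charpoly_fill_eval_eq_zero {ι : Type*} {z : ι → ℂ} (hz : AlgebraicIndependent ℚ z)
    (s : Set ι) {t : ℂ} (ht : IsIntegral (Algebra.adjoin ℚ (z '' s)) t)
    (b : κ → κ → Option ι) (h : (fill b z).charpoly.eval t = 0)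
    {z' : ι → ℂ} (hz' : Set.EqOn z' z s) : (fill b z').charpoly.eval t = 0 := by
  have key : ∀ w : ι → ℂ, (fill b w).charpoly.eval t =
      (fill b (MvPolynomial.X : ι → MvPolynomial ι ℚ)).charpoly.eval₂
        (MvPolynomial.eval₂Hom (algebraMap ℚ ℂ) w) t := by
    intro w
    rw [Polynomial.eval₂_eq_eval_map, ← Matrix.charpoly_map]
    congr 2
    ext y x
    rcases hb : b y x with _ | i <;> simp [fill, hb]
  rw [key] at h ⊢
  exact eval₂_eq_zero_of_eqOn hz s ht _ h hz'

theorem isIntegral_of_charpoly_eval_eq_zero {B : Subalgebra ℚ ℂ} {N : Matrix κ κ ℂ}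
    (hN : ∀ y x, N y x ∈ B) {t : ℂ} (ht : N.charpoly.eval t = 0) : IsIntegral B t := by
  let N₀ : Matrix κ κ B := fun y x => ⟨N y x, hN y x⟩
  refine ⟨N₀.charpoly, N₀.charpoly_monic, ?_⟩
  rw [Polynomial.eval₂_eq_eval_map, ← Matrix.charpoly_map]
  exact ht

theorem charpoly_eval_eq_zero_iff {N : Matrix κ κ ℂ} {t : ℂ} :
    N.charpoly.eval t = 0 ↔ ∃ u, u ≠ 0 ∧ N *ᵥ u = t • u := by
  rw [Matrix.eval_charpoly, ← Matrix.exists_mulVec_eq_zero_iff]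
  refine exists_congr fun u => and_congr_right fun _ => ?_
  rw [Matrix.sub_mulVec, sub_eq_zero, eq_comm]
  simp [Matrix.scalar_apply, ← Matrix.smul_one_eq_diagonal, Matrix.smul_mulVec]

/-- `t` is an eigenvalue of the principal submatrix on `I`, and of no smaller one. -/
structure IsMinimalFor (M : Matrix κ κ ℂ) (t : ℂ) (I : Finset κ) : Prop where
  root : (principal I M).charpoly.eval t = 0
  minimal : ∀ J, J ⊂ I → (principal J M).charpoly.eval t ≠ 0

theorem exists_isMinimalFor {M : Matrix κ κ ℂ} {t : ℂ} (h : M.charpoly.eval t = 0) :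
    ∃ I, IsMinimalFor M t I := by
  have huniv : (principal Finset.univ M).charpoly.eval t = 0 := by
    rw [show principal Finset.univ M = M by ext; simp [principal]]
    exact h
  obtain ⟨I, hI, hmin⟩ := WellFounded.has_min (wellFounded_lt (α := Finset κ))
    {I | (principal I M).charpoly.eval t = 0} ⟨_, huniv⟩
  exact ⟨I, hI, fun J hJ h0 => hmin J h0 hJ⟩

namespace IsMinimalFor

variable {M : Matrix κ κ ℂ} {t : ℂ} {I : Finset κ}

theorem transpose (h : IsMinimalFor M t I) : IsMinimalFor Mᵀ t I :=
  ⟨by rw [← principal_transpose, Matrix.charpoly_transpose]; exact h.root,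
    fun J hJ => by
      rw [← principal_transpose, Matrix.charpoly_transpose]; exact h.minimal J hJ⟩

/-- A nonzero `u` vanishing at `i` would be an eigenvector of the block on `I.erase i`, against
minimality; `t ≠ 0` makes `u` vanish off `I`, where the padded rows are zero. -/
theorem eq_zero_of_apply_eq_zero (h : IsMinimalFor M t I) (ht : t ≠ 0) {u : κ → ℂ}
    (hu : principal I M *ᵥ u = t • u) {i : κ} (hi : i ∈ I) (hui : u i = 0) : u = 0 := by
  by_contra hne
  refine h.minimal (I.erase i) (Finset.erase_ssubset hi) (charpoly_eval_eq_zero_iff.2 ⟨u, hne, ?_⟩)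
  have hout : ∀ y, y ∉ I.erase i → u y = 0 := by
    intro y hy
    by_cases hyI : y ∈ I
    · obtain rfl : y = i := by
        by_contra hyi
        exact hy (Finset.mem_erase.2 ⟨hyi, hyI⟩)
      exact hui
    · have := congrFun hu y
      simp only [Matrix.mulVec, dotProduct, principal, hyI, false_and, if_false, zero_mul,
        Finset.sum_const_zero, Pi.smul_apply, smul_eq_mul] at this
      exact (mul_eq_zero.1 this.symm).resolve_left ht
  ext y
  by_cases hy : y ∈ I.erase i
  · rw [← hu]
    simp only [Matrix.mulVec, dotProduct]
    refine Finset.sum_congr rfl fun x _ => ?_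
    by_cases hx : x ∈ I.erase i
    · simp [principal, hy, hx, Finset.mem_of_mem_erase hx, Finset.mem_of_mem_erase hy,
        -Finset.mem_erase]
    · rw [hout x hx, mul_zero, mul_zero]
  · simp [Matrix.mulVec, dotProduct, principal, hy, hout y hy, -Finset.mem_erase]

theorem exists_left (h : IsMinimalFor M t I) (ht : t ≠ 0) :
    ∃ w : κ → ℂ, (∀ i ∈ I, w i ≠ 0) ∧ w ᵥ* principal I M = t • w := by
  obtain ⟨w, hw0, hw⟩ := charpoly_eval_eq_zero_iff.1 h.transpose.root
  refine ⟨w, fun i hi hwi => hw0 (h.transpose.eq_zero_of_apply_eq_zero ht hw hi hwi), ?_⟩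
  rw [← hw, ← principal_transpose, Matrix.mulVec_transpose]

/-- An extension of the principal submatrix on `I` to a larger set `T` with extra edges allowed
by `PM`, none of them into `I`, such that eigenvectors vanish nowhere on `T`. -/
structure Extension (M : Matrix κ κ ℂ) (t : ℂ) (I : Finset κ) (PM : κ → κ → Prop)
    (T : Finset κ) (N : Matrix κ κ ℂ) : Prop where
  subset : I ⊆ T
  edge : ∀ x y, ¬ PM x y → N y x = 0
  row : ∀ y ∈ I, ∀ x, N y x = principal I M y x
  row_zero : ∀ y, y ∉ T → ∀ x, N y x = 0
  col_zero : ∀ y x, x ∉ T → N y x = 0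
  ker : ∀ u, N *ᵥ u = t • u → ∀ i ∈ T, u i = 0 → u = 0

variable {PM : κ → κ → Prop}

theorem extension_self (h : IsMinimalFor M t I) (ht : t ≠ 0)
    (hPM : ∀ x y, ¬ PM x y → M y x = 0) : Extension M t I PM I (principal I M) where
  subset := subset_rfl
  edge x y hxy := by simp [principal, hPM x y hxy]
  row _ _ _ := rfl
  row_zero y hy x := by simp [principal, hy]
  col_zero y x hx := by simp [principal, hx]
  ker _ hu _ hi hui := h.eq_zero_of_apply_eq_zero ht hu hi hui

/-- Row `k` becomes `u j = t * u k` and column `k` stays zero. An eigenvector with its `k`-th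
coordinate erased is thus an eigenvector of `N` or zero, and `u k` and `u j` vanish together. -/
theorem Extension.insert {T : Finset κ} {N : Matrix κ κ ℂ} (hN : Extension M t I PM T N)
    (ht : t ≠ 0) {j k : κ} (hj : j ∈ T) (hk : k ∉ T) (hjk : PM j k) :
    Extension M t I PM (insert k T) (N + Matrix.single k j 1) where
  subset := hN.subset.trans (Finset.subset_insert _ _)
  edge x y hxy := by
    have : ¬ (k = y ∧ j = x) := by rintro ⟨rfl, rfl⟩; exact hxy hjk
    simp [hN.edge x y hxy, this]
  row y hy x := by
    have : k ≠ y := by rintro rfl; exact hk (hN.subset hy)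
    simp [hN.row y hy x, this]
  row_zero y hy x := by
    rw [Finset.mem_insert, not_or] at hy
    simp [hN.row_zero y hy.2 x, Ne.symm hy.1]
  col_zero y x hx := by
    rw [Finset.mem_insert, not_or] at hx
    have : j ≠ x := by rintro rfl; exact hx.2 hj
    simp [hN.col_zero y x hx.2, this]
  ker u hu i hi hui := by
    have hrow : ∀ y, (N *ᵥ u) y + (if y = k then u j else 0) = t * u y := by
      intro y
      have := congrFun hu y
      rw [Matrix.add_mulVec] at this
      rw [Pi.smul_apply, smul_eq_mul] at this
      rw [← this, Pi.add_apply, Matrix.single_mulVec, one_mul]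
      simp [Function.update_apply]
    have hNk : (N *ᵥ u) k = 0 := by simp [Matrix.mulVec, dotProduct, hN.row_zero k hk]
    have hk' : u j = t * u k := by simpa [hNk] using hrow k
    let u' := Function.update u k 0
    have hNu : N *ᵥ u' = N *ᵥ u := by
      ext y
      refine Finset.sum_congr rfl fun x _ => ?_
      by_cases hx : x = k
      · subst hx; simp [hN.col_zero y x hk]
      · simp [u', hx]
    have hu' : N *ᵥ u' = t • u' := by
      ext y
      rw [hNu]
      by_cases hy : y = k
      · subst hy; simp [hNk, u']
      · have := hrow y
        simp only [hy, if_false, add_zero] at this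
        simp [u', hy, this]
    have hjk' : j ≠ k := by rintro rfl; exact hk hj
    have hz : u' = 0 := by
      rcases Finset.mem_insert.1 hi with rfl | hiT
      · refine hN.ker u' hu' j hj ?_
        simp [u', hjk', hk', hui]
      · refine hN.ker u' hu' i hiT ?_
        have : i ≠ k := by rintro rfl; exact hk hiT
        simp [u', this, hui]
    have huj : u j = 0 := by simpa [u', hjk'] using congrFun hz j
    have huk : u k = 0 := by
      rw [huj] at hk'
      exact (mul_eq_zero.1 hk'.symm).resolve_left ht
    rw [← hz, show u' = u from by simp [u', ← huk]]

/-- The left eigenvector `w` of the block is also one of `N`, because the rows of `N` in `I` are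
those of the block. Pairing it with an eigenvector `u` of the perturbed matrix leaves `w i * u q =
0`. Since `w i ≠ 0`, `u q = 0`, so `u` is an eigenvector of `N` vanishing at `q ∈ T`, which is
excluded. -/
theorem Extension.charpoly_add_single_ne_zero {T : Finset κ} {N : Matrix κ κ ℂ}
    (hN : Extension M t I PM T N) (h : IsMinimalFor M t I) (ht : t ≠ 0) {q i : κ} (hq : q ∈ T)
    (hi : i ∈ I) : (N + Matrix.single i q 1).charpoly.eval t ≠ 0 := by
  intro h0
  obtain ⟨u, hu0, hu⟩ := charpoly_eval_eq_zero_iff.1 h0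
  obtain ⟨w, hw, hwN⟩ := h.exists_left ht
  have hwout : ∀ y, y ∉ I → w y = 0 := by
    intro y hy
    have := congrFun hwN y
    simp only [Matrix.vecMul, dotProduct, principal, hy, and_false, if_false, mul_zero,
      Finset.sum_const_zero, Pi.smul_apply, smul_eq_mul] at this
    exact (mul_eq_zero.1 this.symm).resolve_left ht
  have hwN' : w ᵥ* N = t • w := by
    rw [← hwN]
    ext x
    refine Finset.sum_congr rfl fun y _ => ?_
    by_cases hy : y ∈ I
    · exact congrArg (w y * ·) (hN.row y hy x)
    · simp [hwout y hy]
  have huq : u q = 0 := by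
    have h1 : w ⬝ᵥ ((N + Matrix.single i q 1) *ᵥ u) = t * (w ⬝ᵥ u) := by
      rw [hu, dotProduct_smul, smul_eq_mul]
    rw [Matrix.add_mulVec, dotProduct_add, Matrix.dotProduct_mulVec, hwN', smul_dotProduct,
      smul_eq_mul, add_eq_left, Matrix.single_mulVec, one_mul] at h1
    have h2 : w i * u q = 0 := by
      rw [← h1, dotProduct, Finset.sum_eq_single i]
      · simp
      · intro b _ hb; simp [hb]
      · simp
    exact (mul_eq_zero.1 h2).resolve_left (hw i hi)
  refine hu0 (hN.ker u ?_ q hq huq)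
  rw [← hu, Matrix.add_mulVec, Matrix.single_mulVec, huq, mul_zero]
  simp

theorem exists_extension_closed (h : IsMinimalFor M t I) (ht : t ≠ 0)
    (hPM : ∀ x y, ¬ PM x y → M y x = 0) :
    ∃ T N, Extension M t I PM T N ∧ ∀ j k, j ∈ T → PM j k → k ∈ T := by
  obtain ⟨T, ⟨N, hN⟩, hmax⟩ := WellFounded.has_min (wellFounded_gt (α := Finset κ))
    {T | ∃ N, Extension M t I PM T N} ⟨I, _, h.extension_self ht hPM⟩
  refine ⟨T, N, hN, fun j k hj hjk => ?_⟩
  by_contra hk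
  exact hmax (insert k T) ⟨_, hN.insert ht hj hk hjk⟩ (Finset.ssubset_insert hk)

end IsMinimalFor

end GenericSpectrum
-- Common eigenvalues of matrices with prescribed supports.
namespace GenericSpectrum

open Matrix Relation

variable {κ : Type} [Fintype κ] [DecidableEq κ]

theorem exists_exit {α : Type*} {r : α → α → Prop} {T I : Set α}
    (hT : ∀ x y, x ∈ T → r x y → y ∈ T) {a b : α} (hab : ReflTransGen r a b) (ha : a ∈ T)
    (ha' : a ∉ I) (hb : b ∈ I) : ∃ x y, x ∈ T ∧ x ∉ I ∧ y ∈ I ∧ r x y := by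
  induction hab using ReflTransGen.head_induction_on with
  | refl => exact absurd hb ha'
  | @head a c hac _ ih =>
    by_cases hc : c ∈ I
    · exact ⟨a, c, ha, ha', hc, hac⟩
    · exact ih (hT _ _ ha hac) hc

/-- If the digraph `PA` has a cycle cover and every vertex lies on a closed walk of `PA ⊔ PF`
through an edge of `PF`, then a generic matrix supported on `PA` has no eigenvalue that is shared
by all its perturbations supported on `PF`. -/
theorem exists_forall_exists_charpoly_eval_ne_zero (PA PF : κ → κ → Prop) (π : Equiv.Perm κ)
    (hπ : ∀ y, PA (π y) y)
    (hF : ∀ v, ∃ s r, PF s r ∧ ReflTransGen (fun x y => PA x y ∨ PF x y) v s ∧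
      ReflTransGen (fun x y => PA x y ∨ PF x y) r v) :
    ∃ A : Matrix κ κ ℝ, (∀ x y, ¬ PA x y → A y x = 0) ∧
      ∀ t : ℂ, ∃ G : Matrix κ κ ℝ, (∀ x y, ¬ PF x y → G y x = 0) ∧
        ((A + G).map (algebraMap ℝ ℂ)).charpoly.eval t ≠ 0 := by
  classical
  obtain ⟨zr, hzr⟩ := exists_algebraicIndependent_real (κ × κ × Bool)
  let z : κ × κ × Bool → ℂ := fun i => algebraMap ℝ ℂ (zr i)
  have hz : AlgebraicIndependent ℚ z :=
    hzr.map' (f := (IsScalarTower.toAlgHom ℚ ℝ ℂ)) (algebraMap ℝ ℂ).injective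
  let bA : κ → κ → Option (κ × κ × Bool) := fun y x => if PA x y then some (x, y, false) else none
  let bM : κ → κ → Option (κ × κ × Bool) := fun y x =>
    if PF x y then some (x, y, true) else bA y x
  refine ⟨fill bA zr, fun x y h => by simp [fill, bA, h], fun t => ?_⟩
  by_contra! hfix
  have hA : (fill bA z).charpoly.eval t = 0 := by
    have := hfix 0 (by simp)
    rw [add_zero] at this
    convert this using 3
    ext y x
    by_cases h : PA x y <;> simp [fill, bA, h, z]
  have hM : (fill bM z).charpoly.eval t = 0 := by
    have := hfix (fill bM zr - fill bA zr) (fun x y h => by simp [fill, bM, h])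
    rw [add_sub_cancel] at this
    convert this using 3
    ext y x
    by_cases h : PF x y
    · simp [fill, bM, h, z]
    · by_cases h' : PA x y <;> simp [fill, bM, bA, h, h', z]
  -- Zero is integral over `ℚ`, so every entry may be respecialized: the permutation matrix of `π`
  -- would be singular.
  have ht : t ≠ 0 := by
    rintro rfl
    have h0 := charpoly_fill_eval_eq_zero hz ∅ isIntegral_zero bA hA
      (z' := fun i => if i.1 = π i.2.1 then 1 else 0) (by simp)
    rw [show fill bA (fun i : κ × κ × Bool => if i.1 = π i.2.1 then (1 : ℂ) else 0) =
      π.permMatrix ℂ by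
        ext y x
        by_cases hxy : x = π y
        · subst hxy; simp [fill, bA, hπ, PEquiv.toMatrix_apply, Equiv.Perm.permMatrix]
        · by_cases h : PA x y <;>
            simp [fill, bA, h, hxy, Ne.symm hxy, PEquiv.toMatrix_apply, Equiv.Perm.permMatrix],
      Matrix.eval_charpoly, map_zero, zero_sub, Matrix.det_neg, Matrix.det_permutation] at h0
    rcases Int.units_eq_one_or (Equiv.Perm.sign π) with h | h <;> simp [h] at h0
  obtain ⟨I, hI⟩ := exists_isMinimalFor hM
  let PM : κ → κ → Prop := fun x y => PA x y ∨ PF x y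
  have hPM : ∀ x y, ¬ PM x y → fill bM z y x = 0 := by
    intro x y h
    simp only [PM, not_or] at h
    simp [fill, bM, bA, h.1, h.2]
  let bI : κ → κ → Option (κ × κ × Bool) := fun y x => if y ∈ I ∧ x ∈ I then bM y x else none
  have hbI : principal I (fill bM z) = fill bI z := by
    ext y x
    by_cases h : y ∈ I ∧ x ∈ I <;> simp [principal, fill, bI, h]
  have hroot := hI.root
  rw [hbI] at hroot
  have hInt : IsIntegral (Algebra.adjoin ℚ (z '' {i | i.1 ∈ I ∧ i.2.1 ∈ I})) t := by
    refine isIntegral_of_charpoly_eval_eq_zero (fun y x => ?_) hroot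
    by_cases h : y ∈ I ∧ x ∈ I
    · by_cases hP : PF x y
      · simp only [fill, bI, bM, h, hP]
        exact Algebra.subset_adjoin ⟨(x, y, true), ⟨h.2, h.1⟩, rfl⟩
      · by_cases hP' : PA x y
        · simp only [fill, bI, bM, bA, h, hP, hP']
          exact Algebra.subset_adjoin ⟨(x, y, false), ⟨h.2, h.1⟩, rfl⟩
        · simp [fill, bI, bM, bA, hP, hP']
    · simp [fill, bI, h]
  -- As an eigenvalue of the open-loop matrix, `t` does not involve the parameter of the feedback
  -- edge. Raising that parameter by 1 would keep `t` an eigenvalue of the block, contrary to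
  -- minimality.
  have hnoF : ∀ s ∈ I, ∀ r ∈ I, ¬ PF s r := by
    intro s hs r hr hsr
    have hIntA : IsIntegral (Algebra.adjoin ℚ (z '' {(s, r, true)}ᶜ)) t := by
      refine isIntegral_of_charpoly_eval_eq_zero (fun y x => ?_) hA
      by_cases hP : PA x y
      · simp only [fill, bA, hP]
        exact Algebra.subset_adjoin ⟨(x, y, false), by simp, rfl⟩
      · simp [fill, bA, hP]
    have h1 := charpoly_fill_eval_eq_zero hz _ hIntA bI hroot
      (z' := Function.update z (s, r, true) (z (s, r, true) + 1))
      (fun i hi => Function.update_of_ne hi _ _)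
    refine (hI.extension_self ht hPM).charpoly_add_single_ne_zero hI ht hs hr ?_
    rw [← h1, hbI]
    congr 2
    ext y x
    by_cases hyx : r = y ∧ s = x
    · obtain ⟨rfl, rfl⟩ := hyx
      simp [fill, bI, hs, hr, bM, hsr]
    · have hne : ∀ c, ((x, y, c) : κ × κ × Bool) ≠ (s, r, true) := by
        rintro c h
        simp only [Prod.mk.injEq] at h
        exact hyx ⟨h.2.1.symm, h.1.symm⟩
      rw [Matrix.add_apply, Matrix.single_apply, if_neg hyx, add_zero]
      by_cases h : y ∈ I ∧ x ∈ I
      · by_cases hP : PF x y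
        · simp [fill, bI, bM, h, hP, Function.update_of_ne (hne _)]
        · by_cases hP' : PA x y <;>
            simp [fill, bI, bM, bA, hP, hP', h]
      · simp [fill, bI, h]
  obtain ⟨T, N, hN, hT⟩ := hI.exists_extension_closed ht hPM
  obtain ⟨v, hv⟩ : I.Nonempty := by
    rw [Finset.nonempty_iff_ne_empty]
    rintro rfl
    obtain ⟨u, hu0, hu⟩ := charpoly_eval_eq_zero_iff.1 hI.root
    refine hu0 (funext fun y => ?_)
    have := congrFun hu y
    simpa [principal, Matrix.mulVec, dotProduct, ht] using this
  obtain ⟨s, r, hsr, hvs, hrv⟩ := hF v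
  have hTclosed : ∀ a b, a ∈ T → ReflTransGen PM a b → b ∈ T := by
    intro a b ha hab
    induction hab with
    | refl => exact ha
    | tail _ h ih => exact hT _ _ ih h
  have hsT : s ∈ T := hTclosed v s (hN.subset hv) hvs
  have hsv : ReflTransGen PM s v := .head (Or.inr hsr) hrv
  -- One end of the feedback edge lies outside `I` but in the closed set `T`; from there the walk
  -- returns to `v ∈ I` and must enter `I` from `T \ I`.
  obtain ⟨q, i, hqT, hqI, hiI, hqi⟩ : ∃ x y, x ∈ T ∧ x ∉ I ∧ y ∈ I ∧ PM x y := by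
    by_cases hs : s ∈ I
    · have hr : r ∉ I := fun hr => hnoF s hs r hr hsr
      exact exists_exit (T := (T : Set κ)) (I := (I : Set κ)) (fun x y hx h => hT x y hx h) hrv
        (hT _ _ hsT (Or.inr hsr)) hr hv
    · exact exists_exit (T := (T : Set κ)) (I := (I : Set κ)) (fun x y hx h => hT x y hx h) hsv
        hsT hs hv
  -- Only parameters outside the block on `I` change, so `t` survives, yet the matrix obtained is
  -- `N` plus the returning edge.
  let z' : κ × κ × Bool → ℂ := fun j =>
    if j.1 ∈ I ∧ j.2.1 ∈ I then z j else (N + Matrix.single i q 1 : Matrix κ κ ℂ) j.2.1 j.1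
  have h1 := charpoly_fill_eval_eq_zero hz _ hInt bM hM (z' := z')
    (fun j hj => if_pos hj)
  refine hN.charpoly_add_single_ne_zero hI ht hqT hiI ?_
  rw [← h1]
  congr 2
  ext y x
  by_cases h : x ∈ I ∧ y ∈ I
  · have hqx : ¬ (i = y ∧ q = x) := by rintro ⟨-, rfl⟩; exact hqI h.1
    rw [Matrix.add_apply, Matrix.single_apply, if_neg hqx, add_zero, hN.row y h.2 x]
    by_cases hP : PF x y
    · simp [principal, fill, bM, z', h, hP]
    · by_cases hP' : PA x y <;> simp [principal, fill, bM, bA, z', h, hP, hP']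
  · by_cases hP : PF x y
    · simp only [fill, bM, z', hP, if_true, Option.elim_some]
      exact (if_neg h).symm
    · by_cases hP' : PA x y
      · simp only [fill, bM, bA, z', hP, hP', if_true, if_false, Option.elim_some]
        exact (if_neg h).symm
      · have hxy : ¬ PM x y := by simp [PM, hP, hP']
        have hqx : ¬ (i = y ∧ q = x) := by rintro ⟨rfl, rfl⟩; exact hxy hqi
        simp [fill, bM, bA, hP, hP', hN.edge x y hxy, hqx]

/-- A principal block on which all the matrices of a family agree, and which is the difference of
two sets closed under the edges, contributes common eigenvalues. -/
theorem exists_common_eigenvalue (N : Matrix κ κ ℂ) (U W : κ → Prop) [DecidablePred U]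
    [DecidablePred W] {v : κ} (hvU : U v) (hvW : ¬ W v) :
    ∃ t : ℂ, ∀ M : Matrix κ κ ℂ,
      (∀ x y, U x → ¬ U y → M y x = 0) → (∀ x y, W x → ¬ W y → M y x = 0) →
      (∀ x y, U x → ¬ W x → U y → ¬ W y → M y x = N y x) → M.charpoly.eval t = 0 := by
  let p : {x // U x} → Prop := fun x => W x
  let B : Matrix κ κ ℂ → Matrix {x : {x // U x} // ¬ p x} {x : {x // U x} // ¬ p x} ℂ :=
    fun M y x => M y.1.1 x.1.1
  have : Nonempty {x : {x // U x} // ¬ p x} := ⟨⟨⟨v, hvU⟩, hvW⟩⟩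
  obtain ⟨t, ht⟩ := IsAlgClosed.exists_root (B N).charpoly (by
    rw [Matrix.charpoly_degree_eq_dim]
    exact_mod_cast Fintype.card_ne_zero)
  refine ⟨t, fun M hU hW hMN => ?_⟩
  have hB : B M = B N := by
    ext y x
    exact hMN _ _ x.1.2 x.2 y.1.2 y.2
  rw [Polynomial.IsRoot.def, ← hB, Matrix.eval_charpoly] at ht
  rw [Matrix.eval_charpoly]
  have hoff : ∀ x y : κ, x ≠ y → (scalar κ t - M) y x = - M y x := fun x y h => by
    simp [Matrix.scalar_apply, Matrix.diagonal_apply_ne _ h.symm]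
  rw [Matrix.twoBlockTriangular_det _ U fun y hy x hx => by
    rw [hoff x y (by rintro rfl; exact hy hx), hU x y hx hy, neg_zero]]
  rw [Matrix.twoBlockTriangular_det (toSquareBlockProp (scalar κ t - M) U) p fun y hy x hx => by
    rw [toSquareBlockProp_def, of_apply,
      hoff x.1 y.1 (fun h => hy (by have := Subtype.ext h; exact this ▸ hx)), hW x y hx hy,
      neg_zero]]
  have h2 : toSquareBlockProp (toSquareBlockProp (scalar κ t - M) U) (fun x => ¬ p x) =
      scalar _ t - B M := by
    ext y x
    rw [Matrix.sub_apply, show B M y x = M y.1.1 x.1.1 from rfl]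
    simp [toSquareBlockProp_def, Matrix.scalar_apply, Matrix.diagonal_apply, Subtype.ext_iff]
  rw [h2, ht, mul_zero, zero_mul]

end GenericSpectrum
-- Fixed modes and feedback edges on closed-loop walks.
namespace StructuredControl

open Matrix Relation

variable {n m p : ℕ} (S : StructuredSystem n m p)

namespace StructuredSystem

/-- Some feedback edge of `E` leads from the state `s` to the state `r`. -/
def FeedbackStep (E : Finset (FeedbackEdge m p)) (s r : Fin n) : Prop :=
  ∃ e ∈ E, S.C e.1 s = true ∧ S.B r e.2 = true

/-- The closed-loop digraph on the states. -/
def ClosedLoop (E : Finset (FeedbackEdge m p)) (x y : Fin n) : Prop :=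
  S.stateDigraph.Adj x y ∨ S.FeedbackStep E x y

/-- There is a closed-loop walk from `v` to `x` that uses a feedback edge. -/
def FeedbackReachable (E : Finset (FeedbackEdge m p)) (v x : Fin n) : Prop :=
  ∃ s r, S.FeedbackStep E s r ∧ ReflTransGen (S.ClosedLoop E) v s ∧
    ReflTransGen (S.ClosedLoop E) r x

variable {S} {E : Finset (FeedbackEdge m p)}

theorem mul_mul_apply_eq_zero {B : Matrix (Fin n) (Fin m) ℝ} (hB : B ∈ realizations S.B)
    {C : Matrix (Fin p) (Fin n) ℝ} (hC : C ∈ realizations S.C)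
    {F : Matrix (Fin m) (Fin p) ℝ} (hF : F ∈ realizations (patternOf E)) {x y : Fin n}
    (h : ¬ S.FeedbackStep E x y) : (B * F * C) y x = 0 := by
  rw [Matrix.mul_apply]
  refine Finset.sum_eq_zero fun j _ => ?_
  rw [Matrix.mul_apply, Finset.sum_mul]
  refine Finset.sum_eq_zero fun i _ => ?_
  by_cases hji : (j, i) ∈ E
  · by_cases hBi : S.B y i = true
    · have hCj : S.C j x = false := by
        by_contra hCj
        exact h ⟨(j, i), hji, by simpa using hCj, hBi⟩
      rw [hC j x hCj, mul_zero]
    · rw [hB y i (by simpa using hBi), zero_mul, zero_mul]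
  · rw [hF i j (by simp [patternOf, hji]), mul_zero, zero_mul]

/-- With dedicated inputs and outputs, a single entry of `F` produces a single entry of `B * F * C`;
the general case follows by additivity. -/
theorem exists_realization_mul_mul_eq (hS : S.Dedicated) {G : Matrix (Fin n) (Fin n) ℝ}
    (hG : ∀ x y, ¬ S.FeedbackStep E x y → G y x = 0) :
    ∃ F ∈ realizations (patternOf E),
      (Matrix.of fun y i => if S.B y i then (1 : ℝ) else 0) * F *
        (Matrix.of fun j x => if S.C j x then (1 : ℝ) else 0) = G := by
  set B : Matrix (Fin n) (Fin m) ℝ := Matrix.of fun y i => if S.B y i then (1 : ℝ) else 0 with hB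
  set C : Matrix (Fin p) (Fin n) ℝ := Matrix.of fun j x => if S.C j x then (1 : ℝ) else 0 with hC
  let Q : Matrix (Fin n) (Fin n) ℝ → Prop := fun G =>
    ∃ F ∈ realizations (patternOf E), B * F * C = G
  have hadd : ∀ G G', Q G → Q G' → Q (G + G') := by
    rintro _ _ ⟨F, hF, rfl⟩ ⟨F', hF', rfl⟩
    exact ⟨F + F', fun i j h => by simp [hF i j h, hF' i j h],
      by rw [Matrix.mul_add, Matrix.add_mul]⟩
  have hzero : Q 0 := ⟨0, fun _ _ _ => rfl, by simp⟩
  change Q G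
  rw [Matrix.matrix_eq_sum_single G]
  refine Finset.sum_induction _ Q hadd hzero fun y _ => ?_
  refine Finset.sum_induction _ Q hadd hzero fun x _ => ?_
  by_cases h : S.FeedbackStep E x y
  · obtain ⟨⟨j, i⟩, he, hCe, hBe⟩ := h
    refine ⟨Matrix.single i j (G y x), fun i' j' h' => ?_, ?_⟩
    · have : ¬ (i = i' ∧ j = j') := by
        rintro ⟨rfl, rfl⟩
        simp [patternOf, he] at h'
      simp [this]
    · ext a b
      have hBa : B a i = if y = a then 1 else 0 := by
        by_cases ha : y = a
        · subst ha; simp [hB, hBe]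
        · have : S.B a i = false := by
            by_contra hne
            exact ha ((hS.1 i).unique hBe (by simpa using hne))
          simp [hB, ha, this]
      have hCb : C j b = if x = b then 1 else 0 := by
        by_cases hb : x = b
        · subst hb; simp [hC, hCe]
        · have : S.C j b = false := by
            by_contra hne
            exact hb ((hS.2 j).unique hCe (by simpa using hne))
          simp [hC, hb, this]
      have : (B * Matrix.single i j (G y x) * C) a b = B a i * G y x * C j b := by
        rw [Matrix.mul_apply, Finset.sum_eq_single j]
        · rw [Matrix.mul_single_apply_same]
        · intro j' _ hj'
          rw [Matrix.mul_single_apply_of_ne _ _ _ _ _ hj', zero_mul]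
        · simp
      rw [this, hBa, hCb, Matrix.single_apply]
      by_cases ha : y = a <;> by_cases hb : x = b <;> simp [ha, hb]
  · rw [hG x y h, Matrix.single_zero]
    exact hzero

theorem HasPerfectStateMatching.exists_perm (hA : S.HasPerfectStateMatching) :
    ∃ π : Equiv.Perm (Fin n), ∀ y, S.stateDigraph.Adj (π y) y := by
  obtain ⟨M, hM, hspan⟩ := hA
  have hex : ∀ y, ∃ i, M.Adj (.inl y) (.inr i) := by
    intro y
    obtain ⟨w, hw, -⟩ := hM (hspan (.inl y))
    rcases w with w | w
    · exact (M.adj_sub hw).elim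
    · exact ⟨w, hw⟩
  choose f hf using hex
  have hinj : Function.Injective f := by
    intro a b hab
    have h1 := (hM (hspan (.inr (f a)))).unique (hf a).symm (by rw [hab]; exact (hf b).symm)
    exact Sum.inl_injective h1
  exact ⟨Equiv.ofBijective f (Finite.injective_iff_bijective.1 hinj), fun y => M.adj_sub (hf y)⟩

theorem mem_eigenvalueSet_iff {T : Matrix (Fin n) (Fin n) ℝ} {t : ℂ} :
    t ∈ eigenvalueSet T ↔ (T.map (algebraMap ℝ ℂ)).charpoly.eval t = 0 :=
  Matrix.mem_spectrum_iff_isRoot_charpoly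

theorem noSFM_of_feedbackReachable (hS : S.Dedicated) (hA : S.HasPerfectStateMatching)
    (h : ∀ v, S.FeedbackReachable E v v) : S.NoSFM (patternOf E) := by
  obtain ⟨π, hπ⟩ := hA.exists_perm
  obtain ⟨A, hAr, hfix⟩ := GenericSpectrum.exists_forall_exists_charpoly_eval_ne_zero
    S.stateDigraph.Adj (S.FeedbackStep E) π hπ h
  refine ⟨A, fun i j hij => hAr j i (by simp [stateDigraph, hij]),
    Matrix.of fun y i => if S.B y i then (1 : ℝ) else 0, fun i j hij => by simp [hij],
    Matrix.of fun j x => if S.C j x then (1 : ℝ) else 0, fun i j hij => by simp [hij], ?_⟩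
  refine Set.eq_empty_of_forall_notMem fun t ht => ?_
  obtain ⟨G, hG, hGt⟩ := hfix t
  obtain ⟨F, hF, hFG⟩ := exists_realization_mul_mul_eq hS hG
  have := Set.mem_iInter₂.1 ht F hF
  rw [mem_eigenvalueSet_iff, hFG] at this
  exact hGt this

theorem feedbackReachable_of_noSFM (h : S.NoSFM (patternOf E)) (v : Fin n) :
    S.FeedbackReachable E v v := by
  classical
  by_contra hv
  obtain ⟨A, hA, B, hB, C, hC, hfix⟩ := h
  -- `U` minus `W` is the closed-loop strong component of `v`. A feedback edge inside it would close
  -- a walk through `v`, so its block comes from `A` alone.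
  let U : Fin n → Prop := fun x => ReflTransGen (S.ClosedLoop E) v x
  let W : Fin n → Prop := fun x => U x ∧ ¬ ReflTransGen (S.ClosedLoop E) x v
  obtain ⟨t, ht⟩ := GenericSpectrum.exists_common_eigenvalue (A.map (algebraMap ℝ ℂ)) U W
    (v := v) .refl (fun h => h.2 .refl)
  refine (Set.eq_empty_iff_forall_notMem.1 hfix) t (Set.mem_iInter₂.2 fun F hF => ?_)
  rw [mem_eigenvalueSet_iff]
  have hsupp : ∀ x y, ¬ S.ClosedLoop E x y → (A + B * F * C) y x = 0 := by
    intro x y hxy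
    rw [ClosedLoop, not_or] at hxy
    rw [Matrix.add_apply, mul_mul_apply_eq_zero hB hC hF hxy.2,
      hA y x (by simpa [stateDigraph] using hxy.1), add_zero]
  refine ht _ (fun x y hx hy => ?_) (fun x y hx hy => ?_) fun x y hx hxW hy hyW => ?_
  · rw [Matrix.map_apply, hsupp x y (fun hxy => hy (hx.tail hxy)), map_zero]
  · rw [Matrix.map_apply, hsupp x y (fun hxy => ?_), map_zero]
    exact hy ⟨hx.1.tail hxy, fun hyv => hx.2 (.head hxy hyv)⟩
  · have hyv : ReflTransGen (S.ClosedLoop E) y v := by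
      by_contra hyv
      exact hyW ⟨hy, hyv⟩
    have h0 : (B * F * C) y x = 0 :=
      mul_mul_apply_eq_zero hB hC hF fun hxy => hv ⟨x, y, hxy, hx, hyv⟩
    simp [h0]

end StructuredSystem

/-! ### Simple cycles and closed walks. -/

section Cycles

variable {V : Type}

/-- Loop erasure: when the new first vertex already occurs on the path, only the part from that
occurrence on is kept. -/
theorem exists_nodup_isChain {r : V → V → Prop} {x y : V} (h : ReflTransGen r x y) :
    ∃ l : List V, (x :: l).Nodup ∧ List.IsChain r (x :: l) ∧
      (x :: l).getLast (List.cons_ne_nil _ _) = y := by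
  classical
  induction h using ReflTransGen.head_induction_on with
  | refl => exact ⟨[], by simp⟩
  | @head a c hac _ ih =>
    obtain ⟨l, hnd, hch, hlast⟩ := ih
    by_cases ha : a ∈ c :: l
    · obtain ⟨l₁, l₂, hl⟩ := List.append_of_mem ha
      refine ⟨l₂, ?_, ?_, ?_⟩
      · rw [hl] at hnd; exact (List.nodup_append.1 hnd).2.1
      · rw [hl] at hch; exact hch.right_of_append
      · rw [← hlast]
        simp only [hl, List.getLast_append_of_ne_nil _ (List.cons_ne_nil a l₂)]
    · exact ⟨c :: l, List.nodup_cons.2 ⟨ha, hnd⟩, List.isChain_cons_cons.2 ⟨hac, hch⟩, by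
        rw [List.getLast_cons (List.cons_ne_nil _ _), hlast]⟩

theorem liesInCycle_iff {G : Digraph V} {v : V} : LiesInCycle G v ↔ TransGen G.Adj v v := by
  constructor
  · rintro ⟨c, -, hch, hv⟩
    exact Cycle.chain_iff_pairwise.1 (hch.imp fun _ _ => TransGen.single) v hv v hv
  · intro h
    obtain ⟨b, hvb, hbv⟩ := TransGen.head'_iff.1 h
    obtain ⟨l, hnd, hch, hlast⟩ := exists_nodup_isChain hbv
    refine ⟨(b :: l : List V), Cycle.nodup_coe_iff.2 hnd, ?_, ?_⟩
    · rw [Cycle.chain_ne_nil _ (List.cons_ne_nil _ _), hlast]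
      exact List.isChain_cons_cons.2 ⟨hvb, hch⟩
    · rw [Cycle.mem_coe_iff, ← hlast]
      exact List.getLast_mem _

end Cycles

/-! ### Cycles of the condensed digraph and walks of states. -/

namespace StructuredSystem

variable {S} {E : Finset (FeedbackEdge m p)}

theorem scc_eq_iff {x y : Fin n} : S.scc x = S.scc y ↔
    ReflTransGen S.stateDigraph.Adj x y ∧ ReflTransGen S.stateDigraph.Adj y x :=
  Quotient.eq (r := S.sccSetoid)

theorem ClosedLoop.reflTransGen_of_state {x y : Fin n}
    (h : ReflTransGen S.stateDigraph.Adj x y) : ReflTransGen (S.ClosedLoop E) x y :=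
  ReflTransGen.mono (fun _ _ => Or.inl) _ _ h

theorem FeedbackStep.transGen {s r : Fin n} (h : S.FeedbackStep E s r) :
    TransGen (S.condensedDigraph E).Adj (.comp (S.scc s)) (.comp (S.scc r)) := by
  obtain ⟨⟨j, i⟩, he, hC, hB⟩ := h
  have h₁ : (S.condensedDigraph E).Adj (.comp (S.scc s)) (.output j) := ⟨s, rfl, hC⟩
  have h₂ : (S.condensedDigraph E).Adj (.output j) (.input i) := he
  have h₃ : (S.condensedDigraph E).Adj (.input i) (.comp (S.scc r)) := ⟨r, rfl, hB⟩
  exact .head h₁ (.head h₂ (.single h₃))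

theorem ClosedLoop.condensed {x y : Fin n} (h : ReflTransGen (S.ClosedLoop E) x y) :
    ReflTransGen (S.condensedDigraph E).Adj (.comp (S.scc x)) (.comp (S.scc y)) := by
  induction h with
  | refl => exact .refl
  | @tail b c _ hbc ih =>
    refine ih.trans ?_
    rcases hbc with hbc | hbc
    · by_cases hne : S.scc b = S.scc c
      · rw [hne]
      · exact .single ⟨hne, b, c, rfl, rfl, hbc⟩
    · exact hbc.transGen.to_reflTransGen

theorem FeedbackReachable.transGen {v : Fin n} (h : S.FeedbackReachable E v v) :
    TransGen (S.condensedDigraph E).Adj (.comp (S.scc v)) (.comp (S.scc v)) := by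
  obtain ⟨s, r, hsr, hvs, hrv⟩ := h
  exact (TransGen.trans_right (ClosedLoop.condensed hvs) hsr.transGen).trans_left
    (ClosedLoop.condensed hrv)

variable (S E) in
/-- What a nonempty walk of the condensed digraph from the component of `v` to a given vertex
says about walks of states: a walk between components that uses no feedback edge leaves the
component of `v` for good. -/
def WalkFrom (v : Fin n) : Node S.SCC m p → Prop
  | .comp b => ∀ x, S.scc x = b → S.FeedbackReachable E v x ∨
      ReflTransGen S.stateDigraph.Adj v x ∧ ¬ ReflTransGen S.stateDigraph.Adj x v
  | .output j => ∀ s, S.C j s = true → ReflTransGen (S.ClosedLoop E) v s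
  | .input i => ∀ r, S.B r i = true → ∃ s, S.FeedbackStep E s r ∧
      ReflTransGen (S.ClosedLoop E) v s

theorem FeedbackReachable.trans_state {v x y : Fin n} (h : S.FeedbackReachable E v x)
    (hxy : ReflTransGen S.stateDigraph.Adj x y) : S.FeedbackReachable E v y := by
  obtain ⟨s, r, hsr, hvs, hrx⟩ := h
  exact ⟨s, r, hsr, hvs, hrx.trans (ClosedLoop.reflTransGen_of_state hxy)⟩

theorem FeedbackReachable.reflTransGen {v x : Fin n} (h : S.FeedbackReachable E v x) :
    ReflTransGen (S.ClosedLoop E) v x := by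
  obtain ⟨s, r, hsr, hvs, hrx⟩ := h
  exact (hvs.tail (Or.inr hsr)).trans hrx

/-- Feedback-free steps between distinct components cannot be undone in the state digraph, by
acyclicity of the condensation. Dedicated outputs ensure that the state sensed by an output is the
one through which the walk reached it. -/
theorem walkFrom_of_transGen (hS : S.Dedicated) {v : Fin n} {w : Node S.SCC m p}
    (h : TransGen (S.condensedDigraph E).Adj (.comp (S.scc v)) w) : WalkFrom S E v w := by
  induction h with
  | @single w h =>
    rcases w with b | i | j
    · obtain ⟨hne, x, y, hx, rfl, hxy⟩ := h
      intro y' hy'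
      have hvx := scc_eq_iff.1 hx
      have hyy' := scc_eq_iff.1 hy'
      refine Or.inr ⟨(hvx.2.tail hxy).trans hyy'.2, fun hy'v => hne (scc_eq_iff.2
        ⟨(hvx.2.tail hxy), hyy'.2.trans hy'v⟩)⟩
    · exact h.elim
    · obtain ⟨x, hx, hC⟩ := h
      intro s hs
      obtain rfl := (hS.2 j).unique hC hs
      exact ClosedLoop.reflTransGen_of_state (scc_eq_iff.1 hx).2
  | @tail u w _ h ih =>
    rcases u with a | i | j <;> rcases w with b | i' | j'
    · obtain ⟨hne, x, y, rfl, rfl, hxy⟩ := h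
      intro y' hy'
      have hyy' := (scc_eq_iff.1 hy').2
      rcases ih x rfl with hf | ⟨h1, h2⟩
      · exact Or.inl (hf.trans_state (.head hxy hyy'))
      · exact Or.inr ⟨h1.trans (.head hxy hyy'), fun h => h2 (.head hxy (hyy'.trans h))⟩
    · exact h.elim
    · obtain ⟨x, hx, hC⟩ := h
      intro s hs
      obtain rfl := (hS.2 j').unique hC hs
      rcases ih x hx with hf | ⟨h1, -⟩
      · exact hf.reflTransGen
      · exact ClosedLoop.reflTransGen_of_state h1
    · obtain ⟨r, rfl, hB⟩ := h
      intro x hx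
      obtain ⟨s, hsr, hvs⟩ := ih r hB
      exact Or.inl ⟨s, r, hsr, hvs, ClosedLoop.reflTransGen_of_state (scc_eq_iff.1 hx).2⟩
    · exact h.elim
    · exact h.elim
    · exact h.elim
    · intro r hr
      obtain ⟨s, hs, -⟩ := hS.2 j
      exact ⟨s, ⟨(j, i'), h, hs, hr⟩, ih s hs⟩
    · exact h.elim

theorem forall_liesInCycle_iff (hS : S.Dedicated) :
    (∀ a : S.SCC, LiesInCycle (S.condensedDigraph E) (.comp a)) ↔
      ∀ v, S.FeedbackReachable E v v := by
  constructor
  · intro h v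
    rcases walkFrom_of_transGen hS (liesInCycle_iff.1 (h (S.scc v))) v rfl with hf | hf
    · exact hf
    · exact absurd .refl hf.2
  · intro h a
    obtain ⟨v, rfl⟩ := Quotient.exists_rep a
    exact liesInCycle_iff.2 (h v).transGen

theorem noSFM_patternOf_iff (hS : S.Dedicated) (hA : S.HasPerfectStateMatching) :
    S.NoSFM (patternOf E) ↔ ∀ v, S.FeedbackReachable E v v :=
  ⟨feedbackReachable_of_noSFM, noSFM_of_feedbackReachable hS hA⟩

/-- Replacing feedback edges by others between the same components keeps reachability. -/
theorem FeedbackReachable.of_replacement {E' : Finset (FeedbackEdge m p)}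
    (hE : ∀ e ∈ E, ∀ a b, S.InputAt e.2 a → S.OutputAt b e.1 →
      ∃ e' ∈ E', S.InputAt e'.2 a ∧ S.OutputAt b e'.1)
    {v x : Fin n} (h : S.FeedbackReachable E v x) : S.FeedbackReachable E' v x := by
  have hstep : ∀ s r, S.FeedbackStep E s r → S.FeedbackReachable E' s r := by
    rintro s r ⟨e, he, hC, hB⟩
    obtain ⟨e', he', ⟨r', hr', hB'⟩, ⟨s', hs', hC'⟩⟩ :=
      hE e he (S.scc r) (S.scc s) ⟨r, rfl, hB⟩ ⟨s, rfl, hC⟩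
    exact ⟨s', r', ⟨e', he', hC', hB'⟩, ClosedLoop.reflTransGen_of_state (scc_eq_iff.1 hs').2,
      ClosedLoop.reflTransGen_of_state (scc_eq_iff.1 hr').1⟩
  have hwalk : ∀ y z, ReflTransGen (S.ClosedLoop E) y z →
      ReflTransGen (S.ClosedLoop E') y z := by
    intro y z hyz
    induction hyz with
    | refl => exact .refl
    | tail _ h ih =>
      rcases h with h | h
      · exact ih.tail (Or.inl h)
      · exact ih.trans (hstep _ _ h).reflTransGen
  obtain ⟨s, r, hsr, hvs, hrx⟩ := h
  obtain ⟨s', r', hsr', h1, h2⟩ := hstep s r hsr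
  exact ⟨s', r', hsr', (hwalk _ _ hvs).trans h1, h2.trans (hwalk _ _ hrx)⟩

end StructuredSystem

end StructuredControl
-- Costs, exchange of edges, and comparison of the two optimization problems.
namespace StructuredControl

section Costs

variable {m p : ℕ} (P : Matrix (Fin m) (Fin p) ℝ≥0∞)

theorem exists_eq_patternOf (K : Matrix (Fin m) (Fin p) Bool) :
    ∃ E : Finset (FeedbackEdge m p), K = patternOf E :=
  ⟨Finset.univ.filter fun e => K e.2 e.1 = true, by ext i j; simp [patternOf]⟩

theorem patternCost_patternOf (E : Finset (FeedbackEdge m p)) :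
    patternCost P (patternOf E) = edgeSetCost P E := by
  refine Finset.sum_bij' (fun ij _ => (ij.2, ij.1)) (fun e _ => (e.2, e.1)) ?_ ?_ ?_ ?_ ?_ <;>
    simp [patternOf, edgeCost]

theorem subset_feasibleEdges_of_edgeSetCost_ne_top {E : Finset (FeedbackEdge m p)}
    (h : edgeSetCost P E ≠ ∞) : (E : Set (FeedbackEdge m p)) ⊆ feasibleEdges P :=
  fun _ he => ENNReal.sum_ne_top.1 h _ he

theorem edgeSetCost_ne_top {E : Finset (FeedbackEdge m p)}
    (h : (E : Set (FeedbackEdge m p)) ⊆ feasibleEdges P) : edgeSetCost P E ≠ ∞ :=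
  ENNReal.sum_ne_top.2 fun _ he => h he

/-- Finiteness of the remaining cost keeps the inequality strict in `ℝ≥0∞`; if `e₀` is already
present, the cost only drops further. -/
theorem edgeSetCost_insert_erase_lt {E : Finset (FeedbackEdge m p)}
    (hE : (E : Set (FeedbackEdge m p)) ⊆ feasibleEdges P) {e e₀ : FeedbackEdge m p} (he : e ∈ E)
    (hlt : edgeCost P e₀ < edgeCost P e) :
    edgeSetCost P (insert e₀ (E.erase e)) < edgeSetCost P E := by
  have hrest : edgeSetCost P (E.erase e) ≠ ∞ :=
    edgeSetCost_ne_top P fun _ h => hE (Finset.mem_of_mem_erase h)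
  calc edgeSetCost P (insert e₀ (E.erase e))
      ≤ edgeCost P e₀ + edgeSetCost P (E.erase e) := by
        by_cases h : e₀ ∈ E.erase e
        · rw [Finset.insert_eq_of_mem h]
          exact le_add_self
        · exact (Finset.sum_insert h).le
    _ < edgeCost P e + edgeSetCost P (E.erase e) := ENNReal.add_lt_add_right hrest hlt
    _ = edgeSetCost P E := Finset.add_sum_erase E (edgeCost P) he

end Costs

namespace StructuredSystem

variable {n m p : ℕ} {S : StructuredSystem n m p} {P : Matrix (Fin m) (Fin p) ℝ≥0∞}
  {Emin E : Finset (FeedbackEdge m p)}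

theorem InputAt.unique (hS : S.Dedicated) {i : Fin m} {a b : S.SCC} (ha : S.InputAt i a)
    (hb : S.InputAt i b) : a = b := by
  obtain ⟨x, rfl, hx⟩ := ha
  obtain ⟨y, rfl, hy⟩ := hb
  rw [(hS.1 i).unique hx hy]

theorem OutputAt.unique (hS : S.Dedicated) {j : Fin p} {a b : S.SCC} (ha : S.OutputAt a j)
    (hb : S.OutputAt b j) : a = b := by
  obtain ⟨x, rfl, hx⟩ := ha
  obtain ⟨y, rfl, hy⟩ := hb
  rw [(hS.2 j).unique hx hy]

theorem exists_components (hS : S.Dedicated) (e : FeedbackEdge m p) :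
    ∃ a b, S.InputAt e.2 a ∧ S.OutputAt b e.1 := by
  obtain ⟨x, hx, -⟩ := hS.1 e.2
  obtain ⟨y, hy, -⟩ := hS.2 e.1
  exact ⟨S.scc x, S.scc y, ⟨x, rfl, hx⟩, ⟨y, rfl, hy⟩⟩

theorem IsReducedEdgeSet.subset_feasibleEdges (hEmin : S.IsReducedEdgeSet P Emin) :
    (Emin : Set (FeedbackEdge m p)) ⊆ feasibleEdges P := by
  intro e he
  obtain ⟨a, b, hab⟩ := hEmin.minimal e he
  exact hab.1.1

theorem mem_cycleFeasible_iff (hS : S.Dedicated) (hA : S.HasPerfectStateMatching) :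
    E ∈ S.cycleFeasible Emin ↔ E ⊆ Emin ∧ patternOf E ∈ S.feedbackFeasible :=
  and_congr_right fun _ => (forall_liesInCycle_iff hS).trans (noSFM_patternOf_iff hS hA).symm

theorem patternOf_mem_feedbackFeasible_of_replacement (hS : S.Dedicated)
    (hA : S.HasPerfectStateMatching) {E' : Finset (FeedbackEdge m p)}
    (hE : ∀ e ∈ E, ∀ a b, S.InputAt e.2 a → S.OutputAt b e.1 →
      ∃ e' ∈ E', S.InputAt e'.2 a ∧ S.OutputAt b e'.1)
    (h : patternOf E ∈ S.feedbackFeasible) : patternOf E' ∈ S.feedbackFeasible :=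
  (noSFM_patternOf_iff hS hA).2 fun v =>
    ((noSFM_patternOf_iff hS hA).1 h v).of_replacement hE

/-- Every feasible feedback pattern of finite cost can be replaced by a set of edges of a reduced
edge set that costs no more. -/
theorem IsReducedEdgeSet.exists_mem_cycleFeasible_le (hS : S.Dedicated)
    (hA : S.HasPerfectStateMatching) (hEmin : S.IsReducedEdgeSet P Emin)
    (hE : (E : Set (FeedbackEdge m p)) ⊆ feasibleEdges P)
    (h : patternOf E ∈ S.feedbackFeasible) :
    ∃ E' ∈ S.cycleFeasible Emin, edgeSetCost P E' ≤ edgeSetCost P E := by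
  classical
  have hex : ∀ e : FeedbackEdge m p, ∃ e', e ∈ E → e' ∈ Emin ∧ edgeCost P e' ≤ edgeCost P e ∧
      ∀ a b, S.InputAt e.2 a → S.OutputAt b e.1 → S.InputAt e'.2 a ∧ S.OutputAt b e'.1 := by
    intro e
    obtain ⟨a, b, ha, hb⟩ := exists_components hS e
    by_cases he : e ∈ E
    · obtain ⟨e', he', hmin⟩ := hEmin.represented a b ⟨e, hE he, ha, hb⟩
      refine ⟨e', fun _ => ⟨he', hmin.2 ⟨hE he, ha, hb⟩, fun a' b' ha' hb' => ?_⟩⟩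
      rw [ha'.unique hS ha, hb'.unique hS hb]
      exact hmin.1.2
    · exact ⟨e, fun h => absurd h he⟩
  choose f hf using hex
  refine ⟨E.image f, (mem_cycleFeasible_iff hS hA).2 ⟨?_, ?_⟩, ?_⟩
  · exact Finset.image_subset_iff.2 fun e he => (hf e he).1
  · exact patternOf_mem_feedbackFeasible_of_replacement hS hA
      (fun e he a b ha hb => ⟨f e, Finset.mem_image_of_mem f he, (hf e he).2.2 a b ha hb⟩) h
  · exact (Finset.sum_image_le_of_nonneg fun _ _ => zero_le).trans
      (Finset.sum_le_sum fun e he => (hf e he).2.1)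

theorem IsReducedEdgeSet.solvesCycleSelection_iff (hS : S.Dedicated)
    (hA : S.HasPerfectStateMatching) (hEmin : S.IsReducedEdgeSet P Emin) (hE : E ⊆ Emin) :
    S.SolvesCycleSelection P Emin E ↔ S.SolvesFeedbackSelection P (patternOf E) := by
  constructor
  · rintro ⟨hfeas, hmin⟩
    refine ⟨((mem_cycleFeasible_iff hS hA).1 hfeas).2, fun K hK => ?_⟩
    obtain ⟨E₀, rfl⟩ := exists_eq_patternOf K
    change patternCost P _ ≤ patternCost P _
    rw [patternCost_patternOf, patternCost_patternOf]
    -- Competitors with infeasible edges cannot be moved into `Emin`, but are beaten trivially.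
    by_cases htop : edgeSetCost P E₀ = ∞
    · rw [htop]; exact le_top
    · obtain ⟨E₁, hE₁, hle⟩ := hEmin.exists_mem_cycleFeasible_le hS hA
        (subset_feasibleEdges_of_edgeSetCost_ne_top P htop) hK
      exact (hmin hE₁).trans hle
  · rintro ⟨hfeas, hmin⟩
    refine ⟨(mem_cycleFeasible_iff hS hA).2 ⟨hE, hfeas⟩, fun E₀ hE₀ => ?_⟩
    have := hmin ((mem_cycleFeasible_iff hS hA).1 hE₀).2
    simpa only [Set.mem_ofPred_eq, patternCost_patternOf] using this

/-- Exchange argument: an edge that is not of least cost between its components could be swapped for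
a cheaper one, keeping feasibility and lowering a finite cost. -/
theorem IsReducedEdgeSet.subset_of_solvesFeedbackSelection (hS : S.Dedicated)
    (hA : S.HasPerfectStateMatching) (hEmin : S.IsReducedEdgeSet P Emin)
    (hall : ∀ a b : S.SCC, S.minEdgesBetween P a b ⊆ (Emin : Set (FeedbackEdge m p)))
    (hE : (E : Set (FeedbackEdge m p)) ⊆ feasibleEdges P)
    (h : S.SolvesFeedbackSelection P (patternOf E)) : E ⊆ Emin := by
  intro e he
  obtain ⟨a, b, ha, hb⟩ := exists_components hS e
  obtain ⟨e₀, -, hmin⟩ := hEmin.represented a b ⟨e, hE he, ha, hb⟩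
  rcases le_or_gt (edgeCost P e) (edgeCost P e₀) with hle | hlt
  · exact hall a b ⟨⟨hE he, ha, hb⟩, fun e' he' => hle.trans (hmin.2 he')⟩
  · have hfeas : patternOf (insert e₀ (E.erase e)) ∈ S.feedbackFeasible := by
      refine patternOf_mem_feedbackFeasible_of_replacement hS hA (fun e' he' a' b' ha' hb' => ?_)
        h.1
      by_cases hee' : e' = e
      · subst hee'
        refine ⟨e₀, Finset.mem_insert_self _ _, ?_⟩
        rw [ha'.unique hS ha, hb'.unique hS hb]
        exact hmin.1.2
      · exact ⟨e', Finset.mem_insert_of_mem (Finset.mem_erase.2 ⟨hee', he'⟩), ha', hb'⟩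
    have hle := h.2 hfeas
    simp only [Set.mem_ofPred_eq, patternCost_patternOf] at hle
    exact absurd (edgeSetCost_insert_erase_lt P hE he hlt) (not_lt.2 hle)

theorem IsReducedEdgeSet.epsOptimalFeedbackSelection (hS : S.Dedicated)
    (hA : S.HasPerfectStateMatching) (hEmin : S.IsReducedEdgeSet P Emin) {ε : ℝ≥0}
    (h : S.EpsOptimalCycleSelection P ε Emin E) :
    S.EpsOptimalFeedbackSelection P ε (patternOf E) := by
  obtain ⟨hsub, hfeas⟩ := (mem_cycleFeasible_iff hS hA).1 h.1
  refine ⟨hfeas, fun K hK => ?_⟩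
  obtain ⟨E₀, rfl⟩ := exists_eq_patternOf K
  have hle : ∀ E' : Finset (FeedbackEdge m p), patternOf E' ∈ S.feedbackFeasible →
      edgeSetCost P E₀ ≤ edgeSetCost P E' := fun E' hE' => by
    simpa only [Set.mem_ofPred_eq, patternCost_patternOf] using hK.2 hE'
  -- The optimal pattern has finite cost because `E`, made of feasible edges, competes with it.
  have htop : edgeSetCost P E₀ ≠ ∞ := ne_top_of_le_ne_top
    (edgeSetCost_ne_top P fun _ he => hEmin.subset_feasibleEdges (hsub he)) (hle E hfeas)
  obtain ⟨E₁, hE₁, hE₁le⟩ := hEmin.exists_mem_cycleFeasible_le hS hA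
    (subset_feasibleEdges_of_edgeSetCost_ne_top P htop) hK.1
  rw [patternCost_patternOf, patternCost_patternOf]
  -- `E₁` costs no more than the optimal `E₀`, so it is optimal among the subsets of `Emin`, and the
  -- `ε` bound passes from `E₁` to `E₀`.
  exact (h.2 E₁ ⟨hE₁, fun E' hE' =>
    hE₁le.trans (hle E' ((mem_cycleFeasible_iff hS hA).1 hE').2)⟩).trans (by gcongr)

end StructuredSystem

end StructuredControl

theorem theorem3 {n m p : ℕ} (S : StructuredSystem n m p) (hS : S.Dedicated)
    (hA : S.HasPerfectStateMatching) (P : Matrix (Fin m) (Fin p) ℝ≥0∞)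
    (Emin : Finset (FeedbackEdge m p)) (hEmin : S.IsReducedEdgeSet P Emin) :
    (∀ E' : Finset (FeedbackEdge m p), E' ⊆ Emin →
      (S.SolvesCycleSelection P Emin E' ↔ S.SolvesFeedbackSelection P (patternOf E'))) ∧
    ((∀ a b : S.SCC, S.minEdgesBetween P a b ⊆ (Emin : Set (FeedbackEdge m p))) →
      ∀ E' : Finset (FeedbackEdge m p), (E' : Set (FeedbackEdge m p)) ⊆ feasibleEdges P →
        (S.SolvesCycleSelection P Emin E' ↔ S.SolvesFeedbackSelection P (patternOf E'))) ∧
    (∀ ε : ℝ≥0, 1 ≤ ε → ∀ E' : Finset (FeedbackEdge m p),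
      S.EpsOptimalCycleSelection P ε Emin E' →
        S.EpsOptimalFeedbackSelection P ε (patternOf E')) := by
  exact ⟨fun E h => hEmin.solvesCycleSelection_iff hS hA h,
    fun hall E hE => ⟨fun h => (hEmin.solvesCycleSelection_iff hS hA h.1.1).1 h, fun h =>
      (hEmin.solvesCycleSelection_iff hS hA
        (hEmin.subset_of_solvesFeedbackSelection hS hA hall hE h)).2 h⟩,
    fun ε _ E h => hEmin.epsOptimalFeedbackSelection hS hA h⟩
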